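/- \textbf{Lemma (amplitudes of low-mode states).} Let $1\le M$, $0\le L\le M$ and $n_{\max}\ge 0$. Let $U$ be an $M\times M$ unitary matrix and let $\hat U$ be the associated linear-optical circuit on the Fock space of $M$ bosonic modes, that is, the unitary operator with $\hat U^\dagger \hat a_i\hat U=\sum_{j=1}^M U_{ij}\hat a_j$ for all $i$ and $\hat U|0\rangle=|0\rangle$. Let $$|\psi\rangle=\bigotimes_{i=1}^M\Big(\sum_{m=0}^{n_{\max}}a^{(i)}_m|m\rangle\Big)$$ be a product state, and let $|\phi\rangle$ be a state that is vacuum on all modes except $L$ given modes $e_1,\dots,e_L$, where it equals $|\phi'\rangle=\sum_{k\in\{0,\dots,n_{\max}\}^L}c_k|k\rangle$; here either $|\phi'\rangle$ is a product state, $c_k=\prod_{j}b^{(j)}_{k_j}$, given by the numbers $b^{(j)}_k$, or $|\phi'\rangle$ is arbitrary and given by the numbers $c_k$. (Normalization of the states is not required.) Then $$\langle\phi|\hat U|\psi\rangle=\sum_{k\in\{0,\dots,n_{\max}\}^L}\overline{c_k}\,\sqrt{k_1!\cdots k_L!}\;\big[x_1^{k_1}\cdots x_L^{k_L}\big]\prod_{i=1}^M\sum_{m=0}^{n_{\max}}\frac{a^{(i)}_m}{\sqrt{m!}}\Big(\sum_{j=1}^LU_{e_j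 i}\,x_j\Big)^m .$$ Moreover, there is an absolute constant $C$ such that, in each of the two cases, $\langle\phi|\hat U|\psi\rangle$ is computed exactly, from the entries of $U$ and the coefficients of $|\psi\rangle$ and $|\phi'\rangle$, by a straight-line program that depends only on $M$, $L$, $n_{\max}$ and the positions $e_1,\dots,e_L$. Its steps are: reading an input or a constant, addition, multiplication by a constant, complex conjugation, and multiplication of two computed numbers; all its constants are of the form $q\sqrt k$ with $q\in\mathbb Q$, $k\in\mathbb N$. It performs at most $$C\,M\,(Mn_{\max}+1)^L$$ multiplications of two computed numbers. The total number of its steps, of all kinds, satisfies the same bound $C\,M(Mn_{\max}+1)^L$ if $n_{\max}\le M$, and is at most $C\,(n_{\max}+1)\,M(Mn_{\max}+1)^L$ in general. In particular, for $L=O(1)$ the amplitude is computed in a number of steps polynomial in $M$ and $n_{\max}$. -/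

import Mathlib

noncomputable section

/-! ### Bosonic Fock space -/

/-- The Hilbert space of `M` bosonic modes, written in the photon-number basis: square-summable
families of amplitudes indexed by the occupation numbers `(n₁, …, n_M)`. -/
abbrev FockSpace (M : ℕ) : Type := lp (fun _ : Fin M → ℕ => ℂ) 2

/-- The Fock state `|n₁, …, n_M⟩`. -/
def fockState {M : ℕ} (n : Fin M → ℕ) : FockSpace M := lp.single 2 n (1 : ℂ)

/-- The graph of the (unbounded, closed) annihilation operator of mode `i`: `f` lies in its domain
and is mapped to `g`. In the photon-number basis `(aᵢ f)(n) = √(nᵢ + 1) f(n + eᵢ)`, and the domain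
consists of the `f` for which this family is square summable. -/
def IsAnnihilated {M : ℕ} (i : Fin M) (f g : FockSpace M) : Prop :=
  ∀ n : Fin M → ℕ, g n = (Real.sqrt ((n i : ℝ) + 1) : ℂ) * f (n + Pi.single i 1)

/-- `V` is the linear-optical circuit of the unitary matrix `U`: a unitary operator on Fock space
with `V† aᵢ V = ∑ⱼ Uᵢⱼ aⱼ` on the common domain of the annihilation operators. These relations
determine `V` up to a global phase, which is fixed by `V |0⟩ = |0⟩`. -/
structure IsLinearOptical {M : ℕ} (U : Matrix.unitaryGroup (Fin M) ℂ)
    (V : FockSpace M ≃ₗᵢ[ℂ] FockSpace M) : Prop where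
  vacuum : V (fockState 0) = fockState 0
  annihilation : ∀ (f : FockSpace M) (g : Fin M → FockSpace M),
    (∀ j, IsAnnihilated j f (g j)) →
      ∀ i, IsAnnihilated i (V f) (V (∑ j, (U : Matrix (Fin M) (Fin M) ℂ) i j • g j))

/-- The `M`-mode product state `⨂ᵢ (∑_{m ≤ n} a⁽ⁱ⁾_m |m⟩)` with at most `n` photons per mode. -/
def productState {M n : ℕ} (a : Fin M → Fin (n + 1) → ℂ) : FockSpace M :=
  ∑ m : Fin M → Fin (n + 1), (∏ i, a i (m i)) • fockState (fun i => (m i : ℕ))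

/-- The state `∑ₖ cₖ |k⟩` of the `L` modes `e 0, …, e (L - 1)`, with at most `n` photons per mode;
all the other modes are in the vacuum. -/
def lowModeState {M L n : ℕ} (e : Fin L ↪ Fin M) (c : (Fin L → Fin (n + 1)) → ℂ) : FockSpace M :=
  ∑ k : Fin L → Fin (n + 1), c k • fockState (Function.extend e (fun j => (k j : ℕ)) 0)

/-- The amplitudes of the `L`-mode product state `⨂ⱼ (∑_{k ≤ n} b⁽ʲ⁾_k |k⟩)`. -/
def productAmplitudes {L n : ℕ} (b : Fin L → Fin (n + 1) → ℂ) (k : Fin L → Fin (n + 1)) : ℂ :=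
  ∏ j, b j (k j)

/-- The polynomial `∏ᵢ ∑_{m ≤ n} (a⁽ⁱ⁾_m / √m!) (∑ⱼ U_{e(j) i} xⱼ)ᵐ` in `L` indeterminates. -/
def amplitudePolynomial {M L n : ℕ} (e : Fin L ↪ Fin M) (U : Matrix (Fin M) (Fin M) ℂ)
    (a : Fin M → Fin (n + 1) → ℂ) : MvPolynomial (Fin L) ℂ :=
  ∏ i, ∑ m : Fin (n + 1),
    MvPolynomial.C (a i m / (Real.sqrt ((m : ℕ).factorial : ℝ) : ℂ)) *
      (∑ j, MvPolynomial.C (U (e j) i) * MvPolynomial.X j) ^ (m : ℕ)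

/-! ### Exact computation with complex numbers: straight-line programs -/

/-- Instructions of a straight-line program. The result of each instruction is stored in a new
register; `r` and `s` are numbers of earlier registers. The only constants are the
numbers `q √k` with `q` rational and `k` a natural number. -/
inductive Instr (ι : Type) : Type where
  | input (v : ι)
  | const (q : ℚ) (k : ℕ)
  | add (r s : ℕ)
  | scale (q : ℚ) (k : ℕ) (r : ℕ)
  | conj (r : ℕ)
  | mul (r s : ℕ)

namespace Instr

variable {ι : Type}

/-- The number computed by an instruction, given the input and the contents of the registers. -/
def value (x : ι → ℂ) (mem : List ℂ) : Instr ι → ℂ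
  | input v => x v
  | const q k => (q : ℂ) * (Real.sqrt (k : ℝ) : ℂ)
  | add r s => mem.getD r 0 + mem.getD s 0
  | scale q k r => ((q : ℂ) * (Real.sqrt (k : ℝ) : ℂ)) * mem.getD r 0
  | conj r => (starRingEnd ℂ) (mem.getD r 0)
  | mul r s => mem.getD r 0 * mem.getD s 0

/-- `1` for a multiplication of two computed numbers and `0` for every other instruction. -/
def mulCost : Instr ι → ℕ
  | mul _ _ => 1
  | _ => 0

end Instr

/-- The contents of the registers after all instructions have been executed in order. -/
def runProgram {ι : Type} (P : List (Instr ι)) (x : ι → ℂ) : List ℂ :=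
  P.foldl (fun mem I => mem ++ [I.value x mem]) []

/-- The output of a program: the number computed by its last instruction. -/
def programOutput {ι : Type} (P : List (Instr ι)) (x : ι → ℂ) : ℂ :=
  (runProgram P x).getLastD 0

/-- The number of multiplications of computed numbers that a program performs (its nonscalar
cost). -/
def multiplicationCount {ι : Type} (P : List (Instr ι)) : ℕ := (P.map Instr.mulCost).sum

/-- The total number of steps of a program: every instruction counts, including additions,
multiplications by constants, conjugations, and reading an input or a constant. -/
def stepCount {ι : Type} (P : List (Instr ι)) : ℕ := P.length

/-- The names of the numbers given to the program: the entries of the unitary matrix, the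
coefficients of the product state, and the data (indexed by `κ`) of the low-mode state. -/
inductive Datum (M n : ℕ) (κ : Type) : Type where
  | unitary (i j : Fin M)
  | source (i : Fin M) (m : Fin (n + 1))
  | target (k : κ)

/-- The values of the input numbers. -/
def inputData {M n : ℕ} {κ : Type} (U : Matrix (Fin M) (Fin M) ℂ)
    (a : Fin M → Fin (n + 1) → ℂ) (c : κ → ℂ) : Datum M n κ → ℂ
  | Datum.unitary i j => U i j
  | Datum.source i m => a i m
  | Datum.target k => c k

/-- The cost bounds, with constant `C`: at most `C · M (M n + 1) ^ L` multiplications; the same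
bound for the total number of steps if `n ≤ M`, and a further factor `n + 1` there in general. -/
structure WithinCost {ι : Type} (C M L n : ℕ) (P : List (Instr ι)) : Prop where
  multiplications : multiplicationCount P ≤ C * (M * (M * n + 1) ^ L)
  steps : stepCount P ≤ C * ((n + 1) * (M * (M * n + 1) ^ L))
  steps_of_le : n ≤ M → stepCount P ≤ C * (M * (M * n + 1) ^ L)

end

/-! ### Amplitudes in the Bargmann representation -/

/-! In the Bargmann picture a state with finitely many photons is a polynomial: the amplitude at `N`
is `√(N!)` times the coefficient of `x^N`, and `aᵢ` becomes `∂/∂xᵢ`. By the chain rule, the linear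
substitution `z_j ↦ ∑ᵢ Uᵢⱼ xᵢ` obeys the relations that define the circuit. These relations and the
vacuum condition fix every amplitude, by induction on the photon number, so the circuit acts as this
substitution (`IsLinearOptical.represents`). A low-mode state reads only monomials in the variables
of its `L` modes; setting the other variables to zero leaves the amplitude polynomial
(`inner_lowModeState`).

Only coefficients with all exponents at most `n` are needed, and these can be truncated after each
of the `M` multiplications. One truncated product costs `(2n+1)^L` multiplications: in each
variable, evaluate at `2n+1` rational points, multiply the values and interpolate
(`truncatedConvolution_succ`). Evaluation and interpolation use rational constants only. The factor
of a single mode has explicit coefficients, obtained from a table of monomials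
(`coeff_modePolynomial`). Since `L ≤ M`, `(2n+1)^L ≤ 2(Mn+1)^L`, which gives the cost bounds. -/

/-- The number `√(N₁! ⋯ N_M!)`. -/
noncomputable def sqrtFactorial {M : ℕ} (N : Fin M → ℕ) : ℂ :=
  ∏ j, (Real.sqrt ((N j).factorial : ℝ) : ℂ)

lemma sqrtFactorial_add_single {M : ℕ} (N : Fin M → ℕ) (i : Fin M) :
    sqrtFactorial (N + Pi.single i 1) =
      sqrtFactorial N * (Real.sqrt ((N i : ℝ) + 1) : ℂ) := by
  unfold sqrtFactorial
  rw [← Finset.mul_prod_erase _ _ (Finset.mem_univ i),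
    ← Finset.mul_prod_erase (Finset.univ) (fun j => (Real.sqrt ((N j).factorial : ℝ) : ℂ))
      (Finset.mem_univ i)]
  have h1 : ∏ j ∈ Finset.univ.erase i,
      (Real.sqrt ((((N + Pi.single i 1 : Fin M → ℕ) j).factorial : ℕ) : ℝ) : ℂ) =
      ∏ j ∈ Finset.univ.erase i, (Real.sqrt ((N j).factorial : ℝ) : ℂ) := by
    refine Finset.prod_congr rfl fun j hj => ?_
    simp [Pi.single_eq_of_ne (Finset.ne_of_mem_erase hj)]
  rw [h1]
  have h2 : Real.sqrt ((((N + Pi.single i 1 : Fin M → ℕ) i).factorial : ℕ) : ℝ) =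
      Real.sqrt ((N i).factorial : ℝ) * Real.sqrt ((N i : ℝ) + 1) := by
    rw [← Real.sqrt_mul (by positivity)]
    congr 1
    simp [Nat.factorial_succ, mul_comm]
  rw [h2]
  push_cast
  ring

/-- The state `f` is represented by the polynomial `P`: its amplitudes are the coefficients of `P`
multiplied by `√(N₁! ⋯ N_M!)`. -/
def Represents {M : ℕ} (f : FockSpace M) (P : MvPolynomial (Fin M) ℂ) : Prop :=
  ∀ N : Fin M → ℕ, f N = sqrtFactorial N * P.coeff (Finsupp.equivFunOnFinite.symm N)

namespace Represents

variable {M : ℕ} {f g : FockSpace M} {P Q : MvPolynomial (Fin M) ℂ}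

lemma zero : Represents (0 : FockSpace M) 0 := fun N => by simp

lemma add (hf : Represents f P) (hg : Represents g Q) : Represents (f + g) (P + Q) := fun N => by
  simp [hf N, hg N, mul_add]

lemma smul (c : ℂ) (hf : Represents f P) : Represents (c • f) (MvPolynomial.C c * P) := fun N => by
  simp [hf N, mul_left_comm]

lemma sum {κ : Type*} (s : Finset κ) {F : κ → FockSpace M} {G : κ → MvPolynomial (Fin M) ℂ}
    (h : ∀ k ∈ s, Represents (F k) (G k)) : Represents (∑ k ∈ s, F k) (∑ k ∈ s, G k) := by
  classical
  induction s using Finset.induction_on with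
  | empty => simpa using zero
  | insert k s hk ih =>
    rw [Finset.sum_insert hk, Finset.sum_insert hk]
    exact (h k (by simp)).add (ih fun l hl => h l (by simp [hl]))

lemma sqrtFactorial_ne_zero (N : Fin M → ℕ) : sqrtFactorial N ≠ 0 := by
  unfold sqrtFactorial
  refine Finset.prod_ne_zero_iff.2 fun j _ => ?_
  have : Real.sqrt ((N j).factorial : ℝ) ≠ 0 := by positivity
  exact_mod_cast this

lemma fockState (N : Fin M → ℕ) : Represents (fockState N)
    (MvPolynomial.monomial (Finsupp.equivFunOnFinite.symm N) (sqrtFactorial N)⁻¹) := fun K => by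
  rw [_root_.fockState, lp.single_apply, MvPolynomial.coeff_monomial]
  by_cases h : N = K
  · subst h
    simp [sqrtFactorial_ne_zero]
  · rw [if_neg (by simpa using h), Pi.single_eq_of_ne (Ne.symm h)]
    simp

/-- A polynomial has finitely many coefficients, so summability is no obstacle. This supplies the
states `aⱼ f` that the annihilation relation requires. -/
lemma exists_state (P : MvPolynomial (Fin M) ℂ) : ∃ f : FockSpace M, Represents f P := by
  induction P using MvPolynomial.induction_on' with
  | monomial s c =>
    refine ⟨(c * sqrtFactorial s) • _root_.fockState s, ?_⟩
    have h := (fockState (M := M) s).smul (c * sqrtFactorial s)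
    rw [MvPolynomial.C_mul_monomial] at h
    convert h using 2
    · ext; simp
    · rw [mul_assoc, mul_inv_cancel₀ (sqrtFactorial_ne_zero _), mul_one]
  | add P Q hP hQ =>
    obtain ⟨f, hf⟩ := hP
    obtain ⟨g, hg⟩ := hQ
    exact ⟨f + g, hf.add hg⟩

/-- Differentiation brings down `Nᵢ + 1`; the normalization `√(N!)` absorbs one of its two square
roots. -/
lemma isAnnihilated {i : Fin M} (hf : Represents f P)
    (hg : Represents g (MvPolynomial.pderiv i P)) : IsAnnihilated i f g := fun N => by
  rw [hg, hf, sqrtFactorial_add_single, MvPolynomial.coeff_pderiv]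
  have h1 : (Finsupp.equivFunOnFinite.symm (N + Pi.single i 1) : Fin M →₀ ℕ) =
      Finsupp.equivFunOnFinite.symm N + Finsupp.single i 1 := by
    ext j
    simp [Finsupp.single_apply, Pi.single_apply, eq_comm]
  have h2 : (Real.sqrt ((N i : ℝ) + 1) : ℂ) * (Real.sqrt ((N i : ℝ) + 1) : ℂ) = (N i : ℂ) + 1 := by
    rw [← Complex.ofReal_mul, Real.mul_self_sqrt (by positivity)]
    push_cast
    ring
  rw [h1, Finsupp.equivFunOnFinite_symm_apply_apply, ← h2]
  ring

end Represents

/-- The substitution `z_j ↦ ∑ᵢ Uᵢⱼ xᵢ`. -/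
noncomputable def linearSubstitution {M : ℕ} (U : Matrix (Fin M) (Fin M) ℂ) :
    MvPolynomial (Fin M) ℂ →ₐ[ℂ] MvPolynomial (Fin M) ℂ :=
  MvPolynomial.aeval fun j => ∑ i, MvPolynomial.C (U i j) * MvPolynomial.X i

/-- The chain rule; it is the polynomial form of `aᵢ V = V ∑ⱼ Uᵢⱼ aⱼ`. -/
lemma pderiv_linearSubstitution {M : ℕ} (U : Matrix (Fin M) (Fin M) ℂ) (i : Fin M)
    (P : MvPolynomial (Fin M) ℂ) :
    MvPolynomial.pderiv i (linearSubstitution U P) =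
      linearSubstitution U (∑ j, MvPolynomial.C (U i j) * MvPolynomial.pderiv j P) := by
  classical
  induction P using MvPolynomial.induction_on with
  | C c => simp [linearSubstitution]
  | add P Q hP hQ => simp only [map_add, hP, hQ, mul_add, Finset.sum_add_distrib]
  | mul_X P k hP =>
    have h1 : MvPolynomial.pderiv i (linearSubstitution U (MvPolynomial.X k)) =
        MvPolynomial.C (U i k) := by
      simp [linearSubstitution, MvPolynomial.pderiv_X, Pi.single_apply]
    have h2 : ∑ j, MvPolynomial.C (U i j) * MvPolynomial.pderiv j (P * MvPolynomial.X k) =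
        (∑ j, MvPolynomial.C (U i j) * MvPolynomial.pderiv j P) * MvPolynomial.X k +
          P * MvPolynomial.C (U i k) := by
      simp only [Derivation.leibniz, smul_eq_mul, MvPolynomial.pderiv_X, mul_add,
        Finset.sum_add_distrib, Finset.sum_mul]
      rw [add_comm]
      congr 1
      · exact Finset.sum_congr rfl fun j _ => by ring
      · simp [Pi.single_apply, mul_comm]
    rw [map_mul, Derivation.leibniz, h1, hP, h2, map_add, map_mul, map_mul]
    have h3 : linearSubstitution U (MvPolynomial.C (U i k)) = MvPolynomial.C (U i k) := by
      simp [linearSubstitution]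
    rw [h3]
    simp only [smul_eq_mul]
    ring

lemma IsLinearOptical.represents {M : ℕ} {U : Matrix.unitaryGroup (Fin M) ℂ}
    {V : FockSpace M ≃ₗᵢ[ℂ] FockSpace M} (hV : IsLinearOptical U V) {f : FockSpace M}
    {P : MvPolynomial (Fin M) ℂ} (hf : Represents f P) :
    Represents (V f) (linearSubstitution (U : Matrix (Fin M) (Fin M) ℂ) P) := by
  -- Induction on the photon number of `N`, with `f` and `P` general because the step replaces `f`
  -- by `∑ⱼ Uᵢⱼ aⱼ f`.
  suffices h : ∀ d, ∀ (N : Fin M → ℕ), ∑ i, N i = d → ∀ (f : FockSpace M)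
      (P : MvPolynomial (Fin M) ℂ), Represents f P →
      V f N = sqrtFactorial N * (linearSubstitution (U : Matrix (Fin M) (Fin M) ℂ) P).coeff
        (Finsupp.equivFunOnFinite.symm N) from fun N => h _ N rfl f P hf
  intro d
  induction d with
  | zero =>
    intro N hN f P hf
    have hN0 : N = 0 := funext fun i => (Finset.sum_eq_zero_iff.1 hN) i (Finset.mem_univ i)
    subst hN0
    have h1 : ∀ g : FockSpace M, g 0 = inner ℂ (fockState 0) g := fun g => by
      rw [fockState, lp.inner_single_left]
      simp
    have h2 : (Finsupp.equivFunOnFinite.symm (0 : Fin M → ℕ) : Fin M →₀ ℕ) = 0 := by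
      ext; simp
    -- `⟨0|V f⟩ = ⟨V 0|V f⟩ = ⟨0|f⟩`.
    have h3 : V f 0 = f 0 := by
      rw [h1, h1 f, ← V.inner_map_map (fockState 0) f, hV.vacuum]
    rw [h3, hf, h2, ← MvPolynomial.constantCoeff_eq]
    congr 1
    -- The substituted forms have no constant term, so the constant coefficient is preserved.
    have h4 : (MvPolynomial.constantCoeff (σ := Fin M) (R := ℂ)) =
        (MvPolynomial.constantCoeff.comp
          (linearSubstitution (U : Matrix (Fin M) (Fin M) ℂ)).toRingHom) := by
      refine MvPolynomial.ringHom_ext (fun c => ?_) fun j => ?_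
      · simp [linearSubstitution]
      · simp [linearSubstitution]
    exact congrArg (fun φ => φ P) h4
  | succ d ih =>
    intro N hN f P hf
    obtain ⟨i, -, hi⟩ : ∃ i ∈ Finset.univ, N i ≠ 0 :=
      Finset.exists_ne_zero_of_sum_ne_zero (by omega)
    set K : Fin M → ℕ := N - Pi.single i 1 with hK
    have hNK : N = K + Pi.single i 1 := by
      funext j
      by_cases hj : j = i
      · subst hj
        simp [hK]
        omega
      · simp [hK, Pi.single_eq_of_ne hj]
    have hd : ∑ j, K j = d := by
      rw [hNK] at hN
      simp only [Pi.add_apply, Finset.sum_add_distrib, Finset.sum_pi_single', Finset.mem_univ,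
        if_true] at hN
      omega
    choose g hg using fun j => Represents.exists_state (MvPolynomial.pderiv j P)
    -- The amplitude of `V f` at `K + eᵢ` is read off from that of `aᵢ V f` at `K`, which has one
    -- photon less.
    have h1 := hV.annihilation f g (fun j => hf.isAnnihilated (hg j)) i K
    rw [ih K hd _ _ (Represents.sum Finset.univ fun j _ => (hg j).smul _),
      ← pderiv_linearSubstitution, MvPolynomial.coeff_pderiv] at h1
    have h2 : (Finsupp.equivFunOnFinite.symm (K + Pi.single i 1) : Fin M →₀ ℕ) =
        Finsupp.equivFunOnFinite.symm K + Finsupp.single i 1 := by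
      ext j
      simp [Finsupp.single_apply, Pi.single_apply, eq_comm]
    have h3 : (Real.sqrt ((K i : ℝ) + 1) : ℂ) * (Real.sqrt ((K i : ℝ) + 1) : ℂ) =
        (K i : ℂ) + 1 := by
      rw [← Complex.ofReal_mul, Real.mul_self_sqrt (by positivity)]
      push_cast
      ring
    have h4 : (Real.sqrt ((K i : ℝ) + 1) : ℂ) ≠ 0 := by
      have : Real.sqrt ((K i : ℝ) + 1) ≠ 0 := by positivity
      exact_mod_cast this
    rw [hNK, h2, sqrtFactorial_add_single]
    refine mul_left_cancel₀ h4 ?_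
    rw [← h1, Finsupp.equivFunOnFinite_symm_apply_apply, ← h3]
    ring

lemma represents_productState {M n : ℕ} (a : Fin M → Fin (n + 1) → ℂ) :
    Represents (productState a) (∏ i, ∑ m : Fin (n + 1),
      MvPolynomial.C (a i m / (Real.sqrt ((m : ℕ).factorial : ℝ) : ℂ)) *
        MvPolynomial.X i ^ (m : ℕ)) := by
  classical
  rw [Finset.prod_univ_sum, Fintype.piFinset_univ]
  refine Represents.sum _ fun m _ => ?_
  convert (Represents.fockState fun i => (m i : ℕ)).smul (∏ i, a i (m i)) using 1
  rw [MvPolynomial.C_mul_monomial, MvPolynomial.monomial_eq, Finset.prod_mul_distrib, ← map_prod,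
    Finset.prod_div_distrib, div_eq_mul_inv, sqrtFactorial, Finsupp.prod_fintype _ _ (by simp)]
  simp

/-- `killCompl` sets the variables outside the range of `e` to zero, which keeps exactly the
monomials read by a low-mode state. -/
lemma coeff_killCompl {M L : ℕ} (e : Fin L ↪ Fin M) (P : MvPolynomial (Fin M) ℂ)
    (k : Fin L → ℕ) :
    (MvPolynomial.killCompl e.injective P).coeff (Finsupp.equivFunOnFinite.symm k) =
      P.coeff (Finsupp.equivFunOnFinite.symm (Function.extend e k 0)) := by
  classical
  have hext : (Finsupp.equivFunOnFinite.symm (Function.extend e k 0) : Fin M →₀ ℕ) =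
      (Finsupp.equivFunOnFinite.symm k).mapDomain e := by
    ext i
    by_cases hi : i ∈ Set.range e
    · obtain ⟨j, rfl⟩ := hi
      rw [Finsupp.mapDomain_apply e.injective]
      simp [e.injective.extend_apply]
    · rw [Finsupp.mapDomain_of_notMem_range _ _ hi, Finsupp.equivFunOnFinite_symm_apply_apply,
        Function.extend_apply' _ _ _ (by simpa using hi)]
      rfl
  rw [hext]
  induction P using MvPolynomial.induction_on' with
  | monomial s c =>
    by_cases hs : (s.support : Set (Fin M)) ⊆ Set.range e
    · have h := Finsupp.mapDomain_comapDomain e e.injective s hs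
      rw [← h, MvPolynomial.killCompl_monomial_mapDomain, MvPolynomial.coeff_monomial,
        MvPolynomial.coeff_monomial]
      simp only [(Finsupp.mapDomain_injective e.injective).eq_iff]
    · rw [MvPolynomial.killCompl_monomial_eq_zero_of_not_subset _ _ hs, MvPolynomial.coeff_zero,
        MvPolynomial.coeff_monomial, if_neg]
      rintro rfl
      refine hs fun i hi => ?_
      have := Finsupp.mapDomain_support hi
      simp only [Finset.mem_image] at this
      obtain ⟨j, -, rfl⟩ := this
      exact ⟨j, rfl⟩
  | add P Q hP hQ => simp [hP, hQ]

/-- The sum of coefficients of the amplitude polynomial that gives the amplitude. -/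
noncomputable def amplitudeSum {M L n : ℕ} (e : Fin L ↪ Fin M) (U : Matrix (Fin M) (Fin M) ℂ)
    (a : Fin M → Fin (n + 1) → ℂ) (c : (Fin L → Fin (n + 1)) → ℂ) : ℂ :=
  ∑ k : Fin L → Fin (n + 1),
    (starRingEnd ℂ) (c k) * (∏ j, (Real.sqrt ((k j : ℕ).factorial : ℝ) : ℂ)) *
      MvPolynomial.coeff (Finsupp.equivFunOnFinite.symm (fun j => (k j : ℕ)))
        (amplitudePolynomial e U a)

lemma killCompl_linearSubstitution {M L n : ℕ} (e : Fin L ↪ Fin M)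
    (U : Matrix (Fin M) (Fin M) ℂ) (a : Fin M → Fin (n + 1) → ℂ) :
    MvPolynomial.killCompl e.injective (linearSubstitution U (∏ i, ∑ m : Fin (n + 1),
      MvPolynomial.C (a i m / (Real.sqrt ((m : ℕ).factorial : ℝ) : ℂ)) *
        MvPolynomial.X i ^ (m : ℕ))) = amplitudePolynomial e U a := by
  classical
  have hX : ∀ i, MvPolynomial.killCompl e.injective (linearSubstitution U (MvPolynomial.X i)) =
      ∑ j, MvPolynomial.C (U (e j) i) * MvPolynomial.X j := fun i => by
    simp only [linearSubstitution, MvPolynomial.aeval_X, map_sum, map_mul,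
      MvPolynomial.killCompl_C]
    have hout : ∀ l ∉ Finset.univ.map e, MvPolynomial.C (U l i) *
        MvPolynomial.killCompl e.injective (MvPolynomial.X (R := ℂ) l) = 0 := fun l hl => by
      have : l ∉ Set.range e := by simpa using hl
      rw [MvPolynomial.killCompl, MvPolynomial.aeval_X, dif_neg this, mul_zero]
    rw [← Finset.sum_subset (Finset.subset_univ (Finset.univ.map e)) fun l _ hl => hout l hl,
      Finset.sum_map]
    refine Finset.sum_congr rfl fun j _ => ?_
    rw [← MvPolynomial.rename_X, MvPolynomial.killCompl_rename_app]
  have hC : ∀ c : ℂ, linearSubstitution U (MvPolynomial.C c) = MvPolynomial.C c := fun c => by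
    simp [linearSubstitution]
  simp only [amplitudePolynomial, map_prod, map_sum, map_mul, map_pow, hX, hC,
    MvPolynomial.killCompl_C]

/-- The amplitude of a low-mode state as a sum of coefficients of the amplitude polynomial. -/
theorem inner_lowModeState {M L n : ℕ} (e : Fin L ↪ Fin M) {U : Matrix.unitaryGroup (Fin M) ℂ}
    {V : FockSpace M ≃ₗᵢ[ℂ] FockSpace M} (a : Fin M → Fin (n + 1) → ℂ)
    (c : (Fin L → Fin (n + 1)) → ℂ) (hV : IsLinearOptical U V) :
    inner ℂ (lowModeState e c) (V (productState a)) =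
      amplitudeSum e (U : Matrix (Fin M) (Fin M) ℂ) a c := by
  rw [lowModeState, sum_inner, amplitudeSum]
  refine Finset.sum_congr rfl fun k _ => ?_
  have hfact : sqrtFactorial (Function.extend e (fun j => (k j : ℕ)) 0) =
      ∏ j, (Real.sqrt ((k j : ℕ).factorial : ℝ) : ℂ) := by
    rw [sqrtFactorial, ← Finset.prod_subset (Finset.subset_univ (Finset.univ.map e)),
      Finset.prod_map]
    · simp [e.injective.extend_apply]
    · intro i _ hi
      rw [Function.extend_apply' _ _ _ (by simpa using hi)]
      simp
  rw [inner_smul_left, fockState, lp.inner_single_left,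
    hV.represents (represents_productState a), hfact, ← coeff_killCompl,
    killCompl_linearSubstitution]
  simp [mul_assoc]

/-! ### Composition of straight-line programs -/

section Programs

variable {ι : Type}

lemma runProgram_append_singleton (P : List (Instr ι)) (I : Instr ι) (x : ι → ℂ) :
    runProgram (P ++ [I]) x = runProgram P x ++ [I.value x (runProgram P x)] := by
  simp [runProgram]

lemma length_runProgram (P : List (Instr ι)) (x : ι → ℂ) : (runProgram P x).length = P.length := by
  induction P using List.reverseRecOn with
  | nil => rfl
  | append_singleton P I ih => simp [runProgram_append_singleton, ih]

lemma multiplicationCount_append (P Q : List (Instr ι)) :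
    multiplicationCount (P ++ Q) = multiplicationCount P + multiplicationCount Q := by
  simp [multiplicationCount]

lemma stepCount_append (P Q : List (Instr ι)) :
    stepCount (P ++ Q) = stepCount P + stepCount Q := by
  simp [stepCount]

/-- Some register contains `f x` after the program `P` has been executed on the input `x`. -/
def Stores (P : List (Instr ι)) (f : (ι → ℂ) → ℂ) : Prop :=
  ∃ r < P.length, ∀ x, (runProgram P x).getD r 0 = f x

/-- Registers are only appended, never overwritten, so a register number stays valid in every
continuation. -/
lemma Stores.append {P : List (Instr ι)} {f : (ι → ℂ) → ℂ} (h : Stores P f)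
    (Q : List (Instr ι)) : Stores (P ++ Q) f := by
  induction Q using List.reverseRecOn with
  | nil => simpa using h
  | append_singleton Q I ih =>
    obtain ⟨r, hr, hx⟩ := ih
    refine ⟨r, by simp at hr ⊢; omega, fun x => ?_⟩
    rw [← List.append_assoc, runProgram_append_singleton, List.getD_append, hx]
    rwa [length_runProgram]

lemma stores_append_singleton (P : List (Instr ι)) (I : Instr ι) {f : (ι → ℂ) → ℂ}
    (h : ∀ x, I.value x (runProgram P x) = f x) : Stores (P ++ [I]) f := by
  refine ⟨P.length, by simp, fun x => ?_⟩
  rw [runProgram_append_singleton, List.getD_append_right _ _ _ _ (by simp [length_runProgram]),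
    length_runProgram, ← h]
  simp

/-- Every program that stores the functions in `S` can be continued, with at most `m`
multiplications and `s` steps, so as to store the functions in `T`. -/
def Computes (S T : Set ((ι → ℂ) → ℂ)) (m s : ℕ) : Prop :=
  ∀ P : List (Instr ι), (∀ f ∈ S, Stores P f) →
    ∃ Q, multiplicationCount Q ≤ m ∧ stepCount Q ≤ s ∧ ∀ f ∈ T, Stores (P ++ Q) f

namespace Computes

variable {S S' T T' R : Set ((ι → ℂ) → ℂ)} {m m' s s' : ℕ} {f g : (ι → ℂ) → ℂ}

lemma mono (h : Computes S T m s) (hS : S ⊆ S') (hT : T' ⊆ T) (hm : m ≤ m') (hs : s ≤ s') :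
    Computes S' T' m' s' := fun P hP => by
  obtain ⟨Q, h1, h2, h3⟩ := h P fun f hf => hP f (hS hf)
  exact ⟨Q, h1.trans hm, h2.trans hs, fun f hf => h3 f (hT hf)⟩

lemma of_subset (h : T ⊆ S) : Computes S T 0 0 := fun P hP =>
  ⟨[], by simp [multiplicationCount], by simp [stepCount], fun f hf => by simpa using hP f (h hf)⟩

lemma trans_union (h : Computes S T m s) (h' : Computes (S ∪ T) R m' s') :
    Computes S (T ∪ R) (m + m') (s + s') := fun P hP => by
  obtain ⟨Q, h1, h2, h3⟩ := h P hP
  obtain ⟨Q', h1', h2', h3'⟩ := h' (P ++ Q) (by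
    rintro f (hf | hf)
    · exact (hP f hf).append Q
    · exact h3 f hf)
  refine ⟨Q ++ Q', ?_, ?_, ?_⟩
  · rw [multiplicationCount_append]; omega
  · rw [stepCount_append]; omega
  · rw [← List.append_assoc]
    rintro f (hf | hf)
    · exact (h3 f hf).append Q'
    · exact h3' f hf

lemma trans (h : Computes S T m s) (h' : Computes (S ∪ T) R m' s') :
    Computes S R (m + m') (s + s') :=
  (h.trans_union h').mono subset_rfl Set.subset_union_right le_rfl le_rfl

lemma union (h : Computes S T m s) (h' : Computes S R m' s') :
    Computes S (T ∪ R) (m + m') (s + s') :=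
  h.trans_union (h'.mono Set.subset_union_left subset_rfl le_rfl le_rfl)

lemma iUnion {κ : Type*} [Fintype κ] {T : κ → Set ((ι → ℂ) → ℂ)}
    (h : ∀ k, Computes S (T k) m s) :
    Computes S (⋃ k, T k) (Fintype.card κ * m) (Fintype.card κ * s) := by
  classical
  have key : ∀ t : Finset κ, Computes S (⋃ k ∈ t, T k) (t.card * m) (t.card * s) := fun t => by
    induction t using Finset.induction_on with
    | empty => simpa using of_subset (Set.empty_subset S)
    | insert k t hk ih =>
      rw [Finset.set_biUnion_insert, Finset.card_insert_of_notMem hk]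
      exact ((h k).union ih).mono subset_rfl subset_rfl (by ring_nf; omega) (by ring_nf; omega)
  simpa using key Finset.univ

lemma range {κ : Type*} [Fintype κ] {F : κ → (ι → ℂ) → ℂ} (h : ∀ k, Computes S {F k} m s) :
    Computes S (Set.range F) (Fintype.card κ * m) (Fintype.card κ * s) := by
  simpa [Set.iUnion_singleton_eq_range] using iUnion h

lemma input (v : ι) : Computes S {fun x => x v} 0 1 := fun P _ => by
  refine ⟨[.input v], by simp [multiplicationCount, Instr.mulCost], by simp [stepCount], ?_⟩
  rintro _ rfl
  exact stores_append_singleton P _ fun x => rfl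

lemma const (q : ℚ) (k : ℕ) :
    Computes S {fun _ => (q : ℂ) * (Real.sqrt (k : ℝ) : ℂ)} 0 1 := fun P _ => by
  refine ⟨[.const q k], by simp [multiplicationCount, Instr.mulCost], by simp [stepCount], ?_⟩
  rintro _ rfl
  exact stores_append_singleton P _ fun x => rfl

lemma ratConst (q : ℚ) : Computes S {fun _ => (q : ℂ)} 0 1 := by
  simpa using const (S := S) q 1

lemma mul (hf : f ∈ S) (hg : g ∈ S) : Computes S {f * g} 1 1 := fun P hP => by
  obtain ⟨r, -, hr⟩ := hP f hf
  obtain ⟨t, -, ht⟩ := hP g hg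
  refine ⟨[.mul r t], by simp [multiplicationCount, Instr.mulCost], by simp [stepCount], ?_⟩
  rintro _ rfl
  exact stores_append_singleton P _ fun x => by simp [Instr.value, ← hr, ← ht]

lemma add (hf : f ∈ S) (hg : g ∈ S) : Computes S {f + g} 0 1 := fun P hP => by
  obtain ⟨r, -, hr⟩ := hP f hf
  obtain ⟨t, -, ht⟩ := hP g hg
  refine ⟨[.add r t], by simp [multiplicationCount, Instr.mulCost], by simp [stepCount], ?_⟩
  rintro _ rfl
  exact stores_append_singleton P _ fun x => by simp [Instr.value, ← hr, ← ht]

lemma scale (q : ℚ) (k : ℕ) (hf : f ∈ S) :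
    Computes S {fun x => (q : ℂ) * (Real.sqrt (k : ℝ) : ℂ) * f x} 0 1 := fun P hP => by
  obtain ⟨r, -, hr⟩ := hP f hf
  refine ⟨[.scale q k r], by simp [multiplicationCount, Instr.mulCost], by simp [stepCount], ?_⟩
  rintro _ rfl
  exact stores_append_singleton P _ fun x => by simp [Instr.value, ← hr]

lemma ratScale (q : ℚ) (hf : f ∈ S) : Computes S {fun x => (q : ℂ) * f x} 0 1 := by
  simpa using scale q 1 hf

lemma conj (hf : f ∈ S) : Computes S {fun x => (starRingEnd ℂ) (f x)} 0 1 := fun P hP => by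
  obtain ⟨r, -, hr⟩ := hP f hf
  refine ⟨[.conj r], by simp [multiplicationCount, Instr.mulCost], by simp [stepCount], ?_⟩
  rintro _ rfl
  exact stores_append_singleton P _ fun x => by simp only [Instr.value, ← hr]

/-- A sum of separately computed numbers. -/
lemma sum {κ : Type*} (t : Finset κ) {F : κ → (ι → ℂ) → ℂ} (h : ∀ k, Computes S {F k} m s) :
    Computes S {fun x => ∑ k ∈ t, F k x} (t.card * m) (t.card * (s + 1) + 1) := by
  classical
  induction t using Finset.induction_on with
  | empty => simpa using ratConst (S := S) 0
  | insert k t hk ih =>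
    rw [Finset.card_insert_of_notMem hk]
    refine ((h k).trans ((ih.mono Set.subset_union_left subset_rfl le_rfl le_rfl).trans
      (add (f := F k) (g := fun x => ∑ k ∈ t, F k x) (by simp) (by simp)))).mono
      subset_rfl ?_ (by ring_nf; omega) (by ring_nf; omega)
    rw [Set.singleton_subset_iff, Set.mem_singleton_iff]
    funext x
    simp [Finset.sum_insert hk]

/-- A product of separately computed numbers. -/
lemma prod {κ : Type*} (t : Finset κ) {F : κ → (ι → ℂ) → ℂ} (h : ∀ k, Computes S {F k} m s) :
    Computes S {fun x => ∏ k ∈ t, F k x} (t.card * (m + 1)) (t.card * (s + 1) + 1) := by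
  classical
  induction t using Finset.induction_on with
  | empty => simpa using ratConst (S := S) 1
  | insert k t hk ih =>
    rw [Finset.card_insert_of_notMem hk]
    refine ((h k).trans ((ih.mono Set.subset_union_left subset_rfl le_rfl le_rfl).trans
      (mul (f := F k) (g := fun x => ∏ k ∈ t, F k x) (by simp) (by simp)))).mono
      subset_rfl ?_ (by ring_nf; omega) (by ring_nf; omega)
    rw [Set.singleton_subset_iff, Set.mem_singleton_iff]
    funext x
    simp [Finset.prod_insert hk]

/-- A rational linear combination of stored numbers. -/
lemma linearCombination {κ : Type*} [Fintype κ] (q : κ → ℚ) {F : κ → (ι → ℂ) → ℂ}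
    (h : ∀ k, F k ∈ S) :
    Computes S {fun x => ∑ k, (q k : ℂ) * F k x} 0 (2 * Fintype.card κ + 1) :=
  (sum Finset.univ fun k => ratScale (q k) (h k)).mono subset_rfl subset_rfl (by simp)
    (by rw [Finset.card_univ]; omega)

/-- The powers of a stored number. -/
lemma powers (hf : f ∈ S) (n : ℕ) :
    Computes S (Set.range fun k : Fin (n + 1) => fun x => f x ^ (k : ℕ)) n (n + 1) := by
  induction n with
  | zero =>
    refine (ratConst (S := S) 1).mono subset_rfl ?_ le_rfl le_rfl
    rintro _ ⟨k, rfl⟩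
    simp
  | succ n ih =>
    refine (ih.trans_union (mul (f := fun x => f x ^ n) (g := f)
      (Or.inr ⟨Fin.last n, by simp⟩) (Or.inl hf))).mono subset_rfl ?_ le_rfl le_rfl
    rintro _ ⟨k, rfl⟩
    induction k using Fin.lastCases with
    | last => exact Or.inr (by ext x; simp [pow_succ])
    | cast k => exact Or.inl ⟨k, by simp⟩

/-- All products of one entry from each of `L` stored vectors of length `n + 1`. -/
lemma productTable {n : ℕ} (hn : 1 ≤ n) (L : ℕ) (w : Fin L → Fin (n + 1) → (ι → ℂ) → ℂ)
    (hw : ∀ j k, w j k ∈ S) :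
    Computes S (Set.range fun k : Fin L → Fin (n + 1) => fun x => ∏ j, w j (k j) x)
      (2 * (n + 1) ^ L) (2 * (n + 1) ^ L) := by
  induction L with
  | zero =>
    refine (ratConst (S := S) 1).mono subset_rfl ?_ (by simp) (by simp)
    rintro _ ⟨k, rfl⟩
    simp
  | succ L ih =>
    have h := (ih (fun j => w j.succ) fun j => hw j.succ).trans (range
      (F := fun k : Fin (L + 1) → Fin (n + 1) => w 0 (k 0) *
        fun x => ∏ j : Fin L, w j.succ (k j.succ) x)
      (fun k => mul (Or.inl (hw 0 (k 0))) (Or.inr ⟨fun j => k j.succ, rfl⟩)))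
    -- Since `n ≥ 1`, each further vector at least doubles the table, so the last table pays for all
    -- smaller ones.
    have hle : 2 * (n + 1) ^ L + (n + 1) ^ (L + 1) ≤ 2 * (n + 1) ^ (L + 1) := by
      rw [pow_succ]
      nlinarith [Nat.zero_le ((n + 1) ^ L)]
    refine h.mono subset_rfl ?_ (by simpa using hle) (by simpa using hle)
    rintro _ ⟨k, rfl⟩
    exact ⟨k, by ext x; simp [Fin.prod_univ_succ]⟩

lemma exists_program (h : Computes ∅ {f} m s) :
    ∃ P : List (Instr ι), multiplicationCount P ≤ m ∧ stepCount P ≤ s + 1 ∧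
      ∀ x, programOutput P x = f x := by
  obtain ⟨Q, h1, h2, h3⟩ := h [] (by simp)
  obtain ⟨r, -, hr⟩ := h3 f rfl
  rw [List.nil_append] at hr
  -- The output is the last register; scaling by `1 · √1` copies the result there without a
  -- multiplication of computed numbers.
  refine ⟨Q ++ [.scale 1 1 r], ?_, ?_, fun x => ?_⟩
  · simpa [multiplicationCount_append, multiplicationCount, Instr.mulCost] using h1
  · rw [stepCount_append]; simpa [stepCount] using h2
  · rw [programOutput, runProgram_append_singleton, List.getLastD_concat, Instr.value, hr]
    simp

end Computes

end Programs

/-! ### Truncated products of polynomials -/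

/-- The coefficients `k ≤ n` of the product of two polynomials in `L` indeterminates. -/
def truncatedConvolution {R : Type*} [CommSemiring R] {L n : ℕ} (A B : (Fin L → Fin (n + 1)) → R)
    (k : Fin L → Fin (n + 1)) : R :=
  ∑ u : Fin L → Fin (n + 1), ∑ v : Fin L → Fin (n + 1),
    if ∀ j, (u j : ℕ) + v j = k j then A u * B v else 0

/-- Interpolation at `2n + 1` points recovers the coefficients of a product. -/
lemma exists_interpolation (n : ℕ) : ∃ γ : Fin (n + 1) → Fin (2 * n + 1) → ℚ,
    ∀ k u v : Fin (n + 1),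
      ∑ p, γ k p * (((p : ℕ) : ℚ) ^ (u : ℕ) * ((p : ℕ) : ℚ) ^ (v : ℕ)) =
        if (u : ℕ) + v = k then 1 else 0 := by
  set W : Matrix (Fin (2 * n + 1)) (Fin (2 * n + 1)) ℚ :=
    Matrix.vandermonde fun p => ((p : ℕ) : ℚ) with hW
  have hdet : IsUnit W.det := by
    rw [isUnit_iff_ne_zero, hW, Matrix.det_vandermonde_ne_zero_iff]
    exact fun p q h => Fin.ext (Nat.cast_injective h)
  -- The weights are the rows `k ≤ n` of the inverse Vandermonde matrix at `0, …, 2n`; the exponents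
  -- `u + v ≤ 2n` all lie in its range.
  refine ⟨fun k p => W⁻¹ ⟨k, by omega⟩ p, fun k u v => ?_⟩
  have h := congrFun (congrFun (Matrix.nonsing_inv_mul W hdet) ⟨k, by omega⟩)
    (⟨(u : ℕ) + v, by omega⟩ : Fin (2 * n + 1))
  rw [Matrix.mul_apply, Matrix.one_apply] at h
  simp only [hW, Matrix.vandermonde_apply, Fin.mk.injEq, eq_comm (a := (k : ℕ))] at h
  simpa only [← pow_add] using h

/-- Evaluation of the first variable at `p` reduces the product to one in `L` variables;
interpolation over `p` then extracts the exponent `k 0`. -/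
lemma truncatedConvolution_succ {R : Type*} [CommSemiring R] [Algebra ℚ R] {L n : ℕ}
    {γ : Fin (n + 1) → Fin (2 * n + 1) → ℚ}
    (hγ : ∀ k u v : Fin (n + 1),
      ∑ p, γ k p * (((p : ℕ) : ℚ) ^ (u : ℕ) * ((p : ℕ) : ℚ) ^ (v : ℕ)) =
        if (u : ℕ) + v = k then 1 else 0)
    (A B : (Fin (L + 1) → Fin (n + 1)) → R) (k : Fin (L + 1) → Fin (n + 1)) :
    truncatedConvolution A B k = ∑ p, algebraMap ℚ R (γ (k 0) p) *
      truncatedConvolution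
        (fun u => ∑ u₀ : Fin (n + 1), algebraMap ℚ R (((p : ℕ) : ℚ) ^ (u₀ : ℕ)) *
          A (Fin.cons u₀ u))
        (fun v => ∑ v₀ : Fin (n + 1), algebraMap ℚ R (((p : ℕ) : ℚ) ^ (v₀ : ℕ)) *
          B (Fin.cons v₀ v)) (fun j => k j.succ) := by
  have hsum : ∀ F : (Fin (L + 1) → Fin (n + 1)) → R,
      ∑ u, F u = ∑ u' : Fin L → Fin (n + 1), ∑ u₀ : Fin (n + 1), F (Fin.cons u₀ u') := fun F => by
    rw [← (Fin.consEquiv fun _ => Fin (n + 1)).sum_comp, Fintype.sum_prod_type_right]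
    rfl
  unfold truncatedConvolution
  rw [hsum]
  simp only [hsum (fun v => ite _ _ _)]
  simp only [Finset.sum_mul_sum]
  simp only [Finset.mul_sum]
  rw [Finset.sum_comm (s := (Finset.univ : Finset (Fin (2 * n + 1))))]
  refine Finset.sum_congr rfl fun u _ => ?_
  rw [Finset.sum_comm (s := (Finset.univ : Finset (Fin (n + 1)))),
    Finset.sum_comm (s := (Finset.univ : Finset (Fin (2 * n + 1))))]
  refine Finset.sum_congr rfl fun v _ => ?_
  simp only [Fin.forall_fin_succ, Fin.cons_zero, Fin.cons_succ]
  by_cases huv : ∀ j, (u j : ℕ) + v j = k j.succ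
  · simp only [huv, implies_true, and_true, if_true, Finset.mul_sum]
    rw [Finset.sum_comm (s := (Finset.univ : Finset (Fin (2 * n + 1))))]
    refine Finset.sum_congr rfl fun u₀ _ => ?_
    rw [Finset.sum_comm (s := (Finset.univ : Finset (Fin (2 * n + 1))))]
    refine Finset.sum_congr rfl fun v₀ _ => ?_
    have h := congrArg (algebraMap ℚ R) (hγ (k 0) u₀ v₀)
    rw [map_sum] at h
    calc (if (u₀ : ℕ) + v₀ = k 0 then A (Fin.cons u₀ u) * B (Fin.cons v₀ v) else 0)
        = algebraMap ℚ R (if (u₀ : ℕ) + v₀ = k 0 then 1 else 0) *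
            (A (Fin.cons u₀ u) * B (Fin.cons v₀ v)) := by split_ifs <;> simp
      _ = _ := by
        rw [← h, Finset.sum_mul]
        refine Finset.sum_congr rfl fun p _ => ?_
        rw [map_mul, map_mul]
        ring
  · simp [huv]

/-- The number of steps of the truncated product of two polynomials in `L` indeterminates. -/
def convolutionSteps (n : ℕ) : ℕ → ℕ
  | 0 => 1
  | L + 1 => (2 * n + 1) * (2 * ((n + 1) ^ L * (2 * n + 3)) + convolutionSteps n L) +
      (n + 1) ^ (L + 1) * (4 * n + 3)

/-- The extra term on the left strengthens the induction: `(2n+1) · 27(n+1)^(L+1) - 27(n+1)^(L+2) =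
27n(n+1)^(L+1)` absorbs the `(12n² + 23n + 9)(n+1)^L` steps of evaluation and interpolation. -/
lemma convolutionSteps_le {n : ℕ} (hn : 1 ≤ n) (L : ℕ) :
    convolutionSteps n L + 27 * (n + 1) ^ (L + 1) ≤
      (2 * n + 1) ^ L + 27 * (n + 1) * (2 * n + 1) ^ L := by
  induction L with
  | zero => simp [convolutionSteps]
  | succ L ih =>
    rw [convolutionSteps]
    have h := Nat.mul_le_mul_left (2 * n + 1) ih
    generalize convolutionSteps n L = c at *
    rw [pow_succ (2 * n + 1)]
    have hr : (n + 1) ^ (L + 1 + 1) = (n + 1) ^ L * (n + 1) * (n + 1) := by ring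
    rw [hr, pow_succ (n + 1) L]
    rw [pow_succ (n + 1) L] at h
    generalize (n + 1) ^ L = r at *
    generalize (2 * n + 1) ^ L = q at *
    have h2 : r ≤ r * n := Nat.le_mul_of_pos_right _ hn
    have h3 : r * n ≤ r * n * n := Nat.le_mul_of_pos_right _ hn
    nlinarith

/-- Multiplications of computed numbers occur only at the `(2n+1)^L` leaves of the recursion over
the variables. -/
lemma Computes.truncatedConvolution {ι : Type} (n L : ℕ)
    (A B : (Fin L → Fin (n + 1)) → (ι → ℂ) → ℂ) :
    Computes (Set.range A ∪ Set.range B) (Set.range (truncatedConvolution A B))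
      ((2 * n + 1) ^ L) (convolutionSteps n L) := by
  induction L with
  | zero =>
    refine (mul (S := Set.range A ∪ Set.range B) (f := A default) (g := B default)
      (Or.inl ⟨_, rfl⟩) (Or.inr ⟨_, rfl⟩)).mono subset_rfl ?_ (by simp) (by simp [convolutionSteps])
    rintro _ ⟨k, rfl⟩
    simp only [_root_.truncatedConvolution, Fintype.sum_unique, IsEmpty.forall_iff, if_true,
      Set.mem_singleton_iff]
    exact congrArg₂ (fun u v => A u * B v) (Subsingleton.elim _ _) (Subsingleton.elim _ _)
  | succ L ih =>
    obtain ⟨γ, hγ⟩ := exists_interpolation n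
    -- Partial evaluation of the first variable at `p`.
    let ev (p : Fin (2 * n + 1)) (A : (Fin (L + 1) → Fin (n + 1)) → (ι → ℂ) → ℂ)
      (u : Fin L → Fin (n + 1)) : (ι → ℂ) → ℂ :=
      ∑ u₀ : Fin (n + 1), algebraMap ℚ ((ι → ℂ) → ℂ) (((p : ℕ) : ℚ) ^ (u₀ : ℕ)) *
          A (Fin.cons u₀ u)
    have hev : ∀ p A, Computes (Set.range A) (Set.range (ev p A)) 0
        ((n + 1) ^ L * (2 * n + 3)) := fun p A => by
      have h := range (F := ev p A) (S := Set.range A) (m := 0) (s := 2 * n + 3) fun u => by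
        refine (linearCombination (S := Set.range A) (fun u₀ : Fin (n + 1) => ((p : ℕ) : ℚ) ^ (u₀ : ℕ))
          (F := fun u₀ => A (Fin.cons u₀ u)) fun u₀ => ⟨_, rfl⟩).mono subset_rfl ?_ le_rfl
          (by rw [Fintype.card_fin]; omega)
        rw [Set.singleton_subset_iff, Set.mem_singleton_iff]
        funext x
        simp [ev]
      simpa using h
    have hstep : ∀ p, Computes (Set.range A ∪ Set.range B)
        (Set.range (_root_.truncatedConvolution (ev p A) (ev p B))) ((2 * n + 1) ^ L)
        (2 * ((n + 1) ^ L * (2 * n + 3)) + convolutionSteps n L) := fun p => by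
      have h1 := (hev p A).mono (S' := Set.range A ∪ Set.range B) Set.subset_union_left subset_rfl
        le_rfl le_rfl
      have h2 := (hev p B).mono (S' := Set.range A ∪ Set.range B) Set.subset_union_right subset_rfl
        le_rfl le_rfl
      exact ((h1.union h2).trans ((ih (ev p A) (ev p B)).mono Set.subset_union_right subset_rfl
        le_rfl le_rfl)).mono subset_rfl subset_rfl (by omega) (by omega)
    have hfin := (iUnion hstep).trans (range (F := _root_.truncatedConvolution A B) (m := 0)
      (s := 4 * n + 3) fun k => by
        refine (linearCombination (γ (k 0)) (F := fun p =>
          _root_.truncatedConvolution (ev p A) (ev p B) fun j => k j.succ) fun p =>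
            Or.inr (Set.mem_iUnion.2 ⟨p, Set.mem_range_self _⟩)).mono subset_rfl ?_ le_rfl
            (by rw [Fintype.card_fin]; omega)
        rw [Set.singleton_subset_iff, Set.mem_singleton_iff, truncatedConvolution_succ hγ]
        funext x
        simp [ev])
    refine hfin.mono subset_rfl subset_rfl ?_ ?_
    · simp [pow_succ, mul_comm]
    · simp [convolutionSteps]

/-! ### Coefficients of the amplitude polynomial -/

/-- If `u + v = k` and `k ≤ n` componentwise, then `u, v ≤ n`, so truncation loses nothing. -/
lemma coeff_mul_eq_truncatedConvolution {R : Type*} [CommSemiring R] {L n : ℕ}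
    (P Q : MvPolynomial (Fin L) R) (k : Fin L → Fin (n + 1)) :
    (P * Q).coeff (Finsupp.equivFunOnFinite.symm fun j => (k j : ℕ)) =
      truncatedConvolution
        (fun u => P.coeff (Finsupp.equivFunOnFinite.symm fun j => (u j : ℕ)))
        (fun v => Q.coeff (Finsupp.equivFunOnFinite.symm fun j => (v j : ℕ))) k := by
  classical
  rw [MvPolynomial.coeff_mul, truncatedConvolution, ← Fintype.sum_prod_type', ← Finset.sum_filter]
  symm
  refine Finset.sum_nbij (fun p => ((Finsupp.equivFunOnFinite.symm fun j => (p.1 j : ℕ)),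
    (Finsupp.equivFunOnFinite.symm fun j => (p.2 j : ℕ)))) ?_ ?_ ?_ fun _ _ => rfl
  · rintro ⟨u, v⟩ h
    rw [Finset.mem_filter] at h
    rw [Finset.HasAntidiagonal.mem_antidiagonal]
    ext j
    simpa using h.2 j
  · rintro ⟨u, v⟩ - ⟨u', v'⟩ - h
    simp only [Prod.mk.injEq, EmbeddingLike.apply_eq_iff_eq, funext_iff, Fin.val_inj] at h
    exact Prod.ext (funext h.1) (funext h.2)
  · rintro ⟨u, v⟩ h
    rw [Finset.mem_coe, Finset.HasAntidiagonal.mem_antidiagonal] at h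
    have hj : ∀ j, u j + v j = k j := fun j => by
      simpa using DFunLike.congr_fun h j
    refine ⟨(fun j => ⟨u j, by have := hj j; omega⟩, fun j => ⟨v j, by have := hj j; omega⟩),
      ?_, ?_⟩
    · simpa using hj
    · ext <;> simp

lemma coeff_linear_pow {R : Type*} [CommSemiring R] {L : ℕ} (u : Fin L → R) (m : ℕ)
    (k : Fin L → ℕ) :
    ((∑ j, MvPolynomial.C (u j) * MvPolynomial.X j) ^ m).coeff
        (Finsupp.equivFunOnFinite.symm k) =
      if ∑ j, k j = m then (Nat.multinomial Finset.univ k : R) * ∏ j, u j ^ k j else 0 := by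
  classical
  have hmon : ∀ κ : Fin L → ℕ, ((Nat.multinomial Finset.univ κ : ℕ) : MvPolynomial (Fin L) R) *
      ∏ j, (MvPolynomial.C (u j) * MvPolynomial.X j) ^ κ j =
      MvPolynomial.monomial (Finsupp.equivFunOnFinite.symm κ)
        ((Nat.multinomial Finset.univ κ : R) * ∏ j, u j ^ κ j) := fun κ => by
    rw [MvPolynomial.monomial_eq, Finsupp.prod_fintype _ _ (by simp)]
    simp [mul_pow, Finset.prod_mul_distrib, mul_assoc]
  rw [Finset.sum_pow_eq_sum_piAntidiag, MvPolynomial.coeff_sum]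
  simp only [hmon, MvPolynomial.coeff_monomial, EmbeddingLike.apply_eq_iff_eq]
  rw [Finset.sum_ite_eq']
  simp

/-- The factor of the amplitude polynomial that belongs to one mode. -/
noncomputable def modePolynomial {L n : ℕ} (u : Fin L → ℂ) (a : Fin (n + 1) → ℂ) :
    MvPolynomial (Fin L) ℂ :=
  ∑ m : Fin (n + 1), MvPolynomial.C (a m / (Real.sqrt ((m : ℕ).factorial : ℝ) : ℂ)) *
    (∑ j, MvPolynomial.C (u j) * MvPolynomial.X j) ^ (m : ℕ)

lemma amplitudePolynomial_eq {M L n : ℕ} (e : Fin L ↪ Fin M) (U : Matrix (Fin M) (Fin M) ℂ)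
    (a : Fin M → Fin (n + 1) → ℂ) :
    amplitudePolynomial e U a = ∏ i, modePolynomial (fun j => U (e j) i) (a i) := rfl

/-- Only the summand of degree `∑ kⱼ` contributes. Writing `1/√d!` as `√d!/d!` puts the constant in
the admissible form `q√k`. -/
lemma coeff_modePolynomial {L n : ℕ} (u : Fin L → ℂ) (a : Fin (n + 1) → ℂ) (k : Fin L → ℕ) :
    (modePolynomial u a).coeff (Finsupp.equivFunOnFinite.symm k) =
      if h : ∑ j, k j < n + 1 then
        (((Nat.multinomial Finset.univ k : ℚ) / ((∑ j, k j).factorial : ℚ) : ℚ) : ℂ) *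
          (Real.sqrt (((∑ j, k j).factorial : ℕ) : ℝ) : ℂ) *
            (a ⟨∑ j, k j, h⟩ * ∏ j, u j ^ k j)
      else 0 := by
  rw [modePolynomial, MvPolynomial.coeff_sum]
  simp only [MvPolynomial.coeff_C_mul, coeff_linear_pow, mul_ite, mul_zero]
  split_ifs with h
  · rw [Finset.sum_eq_single ⟨∑ j, k j, h⟩]
    · rw [if_pos rfl]
      generalize ∑ j, k j = d at h ⊢
      have h1 : (Real.sqrt ((d.factorial : ℕ) : ℝ) : ℂ) ≠ 0 := by
        have : Real.sqrt ((d.factorial : ℕ) : ℝ) ≠ 0 := by positivity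
        exact_mod_cast this
      have h2 : (Real.sqrt ((d.factorial : ℕ) : ℝ) : ℂ) * (Real.sqrt ((d.factorial : ℕ) : ℝ) : ℂ) =
          (d.factorial : ℂ) := by
        rw [← Complex.ofReal_mul, Real.mul_self_sqrt (by positivity)]
        simp
      push_cast
      rw [← h2]
      field_simp
    · rintro m - hm
      exact if_neg fun h' => hm (Fin.ext h'.symm)
    · simp
  · refine Finset.sum_eq_zero fun m _ => if_neg fun h' => h ?_
    rw [h']
    exact m.2

/-- The case `n = 0` is separate because `(n+1)^L = 1` then no longer dominates `L`. -/
lemma amplitudeSum_zero {M L : ℕ} (e : Fin L ↪ Fin M) (U : Matrix (Fin M) (Fin M) ℂ)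
    (a : Fin M → Fin (0 + 1) → ℂ) (c : (Fin L → Fin (0 + 1)) → ℂ) :
    amplitudeSum e U a c = (starRingEnd ℂ) (c default) * ∏ i, a i 0 := by
  have h : (Finsupp.equivFunOnFinite.symm fun j : Fin L => (((default : Fin L → Fin (0 + 1)) j :
      Fin (0 + 1)) : ℕ)) = 0 := by
    ext; simp
  have : Subsingleton (Fin (0 + 1)) := inferInstanceAs (Subsingleton (Fin 1))
  rw [amplitudeSum, Fintype.sum_subsingleton _ default, h, ← MvPolynomial.constantCoeff_eq]
  simp [amplitudePolynomial]

/-! ### Programs for the amplitude -/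

namespace Computes

variable {ι : Type} {L n : ℕ}

lemma coeff_mul {A B : (ι → ℂ) → MvPolynomial (Fin L) ℂ} :
    Computes
      ((Set.range fun (k : Fin L → Fin (n + 1)) (x : ι → ℂ) =>
          (A x).coeff (Finsupp.equivFunOnFinite.symm fun j => (k j : ℕ))) ∪
        Set.range fun (k : Fin L → Fin (n + 1)) (x : ι → ℂ) =>
          (B x).coeff (Finsupp.equivFunOnFinite.symm fun j => (k j : ℕ)))
      (Set.range fun (k : Fin L → Fin (n + 1)) (x : ι → ℂ) =>
        (A x * B x).coeff (Finsupp.equivFunOnFinite.symm fun j => (k j : ℕ)))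
      ((2 * n + 1) ^ L) (convolutionSteps n L) := by
  refine (truncatedConvolution n L _ _).mono subset_rfl ?_ le_rfl le_rfl
  rintro _ ⟨k, rfl⟩
  refine ⟨k, ?_⟩
  funext x
  refine Eq.trans ?_ (coeff_mul_eq_truncatedConvolution (A x) (B x) k).symm
  simp only [_root_.truncatedConvolution, Finset.sum_apply]
  refine Finset.sum_congr rfl fun u _ => Finset.sum_congr rfl fun v _ => ?_
  split_ifs <;> rfl

lemma coeff_modePolynomial (hn : 1 ≤ n) (u : Fin L → ι) (a : Fin (n + 1) → ι) :
    Computes ∅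
      (Set.range fun (k : Fin L → Fin (n + 1)) (x : ι → ℂ) =>
        (modePolynomial (fun j => x (u j)) fun m => x (a m)).coeff
          (Finsupp.equivFunOnFinite.symm fun j => (k j : ℕ)))
      (7 * (n + 1) ^ L) (7 * (n + 1) ^ L) := by
  have hpow : ∀ j, Computes ∅
      (Set.range fun (k : Fin (n + 1)) (x : ι → ℂ) => x (u j) ^ (k : ℕ)) n (n + 2) := fun j =>
    ((input (u j)).trans (powers (by simp) n)).mono subset_rfl subset_rfl (by omega) (by omega)
  have htab := (iUnion hpow).trans (productTable hn L
    (fun j k x => x (u j) ^ (k : ℕ)) fun j k => Or.inr (Set.mem_iUnion.2 ⟨j, k, rfl⟩))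
  have hLr : (n + 1) * L ≤ (n + 1) ^ L := Nat.mul_le_pow (by omega) L
  refine (htab.trans (range (m := 1) (s := 3) fun k => ?_)).mono subset_rfl subset_rfl ?_ ?_
  · by_cases h : ∑ j, (k j : ℕ) < n + 1
    · refine ((input (a ⟨_, h⟩)).trans ((mul (f := fun x => x (a ⟨_, h⟩))
        (g := fun x => ∏ j, x (u j) ^ (k j : ℕ)) (by simp)
        (Or.inl (Or.inr ⟨k, rfl⟩))).trans (scale
          ((Nat.multinomial Finset.univ (fun j => (k j : ℕ)) : ℚ) /
            ((∑ j, (k j : ℕ)).factorial : ℚ))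
          (∑ j, (k j : ℕ)).factorial (Or.inr rfl)))).mono subset_rfl ?_ le_rfl le_rfl
      rw [Set.singleton_subset_iff, Set.mem_singleton_iff]
      funext x
      rw [_root_.coeff_modePolynomial, dif_pos h]
      rfl
    · refine (ratConst 0).mono subset_rfl ?_ (by omega) (by omega)
      rw [Set.singleton_subset_iff, Set.mem_singleton_iff]
      funext x
      rw [_root_.coeff_modePolynomial, dif_neg h]
      simp
  · simp only [Fintype.card_fin, Fintype.card_pi, Finset.prod_const, Finset.card_univ]
    nlinarith
  · simp only [Fintype.card_fin, Fintype.card_pi, Finset.prod_const, Finset.card_univ]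
    nlinarith

lemma coeff_prod_modePolynomial (hn : 1 ≤ n) {M : ℕ} (u : Fin M → Fin L → ι)
    (a : Fin M → Fin (n + 1) → ι) :
    Computes ∅
      (Set.range fun (k : Fin L → Fin (n + 1)) (x : ι → ℂ) =>
        (∏ i, modePolynomial (fun j => x (u i j)) fun m => x (a i m)).coeff
          (Finsupp.equivFunOnFinite.symm fun j => (k j : ℕ)))
      (M * ((2 * n + 1) ^ L + 7 * (n + 1) ^ L))
      (M * (convolutionSteps n L + 7 * (n + 1) ^ L) + (n + 1) ^ L) := by
  classical
  have key : ∀ t : Finset (Fin M), Computes ∅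
      (Set.range fun (k : Fin L → Fin (n + 1)) (x : ι → ℂ) =>
        (∏ i ∈ t, modePolynomial (fun j => x (u i j)) fun m => x (a i m)).coeff
          (Finsupp.equivFunOnFinite.symm fun j => (k j : ℕ)))
      (t.card * ((2 * n + 1) ^ L + 7 * (n + 1) ^ L))
      (t.card * (convolutionSteps n L + 7 * (n + 1) ^ L) + (n + 1) ^ L) := fun t => by
    induction t using Finset.induction_on with
    | empty =>
      -- The coefficients of the empty product are constants `0` or `1`; loading them accounts for
      -- the additional `(n+1)^L` steps.
      refine (range (m := 0) (s := 1) fun k => ?_).mono subset_rfl subset_rfl (by simp) (by simp)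
      refine (ratConst (if (0 : Fin L →₀ ℕ) = Finsupp.equivFunOnFinite.symm fun j => (k j : ℕ)
        then 1 else 0)).mono subset_rfl ?_ le_rfl le_rfl
      rw [Set.singleton_subset_iff, Set.mem_singleton_iff]
      funext x
      rw [Finset.prod_empty, MvPolynomial.coeff_one]
      split_ifs <;> simp
    | insert i t hi ih =>
      rw [Finset.card_insert_of_notMem hi]
      simp only [Finset.prod_insert hi]
      refine (((coeff_modePolynomial hn (u i) (a i)).union ih).trans
        (coeff_mul.mono Set.subset_union_right subset_rfl le_rfl le_rfl)).mono subset_rfl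
          subset_rfl ?_ ?_
      · ring_nf; omega
      · ring_nf; omega
  simpa using key Finset.univ

/-- The amplitude is computed from the data and the conjugate amplitudes of the low-mode state. -/
lemma amplitudeSum {M : ℕ} {κ : Type} (hn : 1 ≤ n) (e : Fin L ↪ Fin M)
    {c : (Fin L → Fin (n + 1)) → (Datum M n κ → ℂ) → ℂ} {m s : ℕ}
    (hc : Computes ∅ (Set.range fun k x => (starRingEnd ℂ) (c k x)) m s) :
    Computes ∅ {fun x => amplitudeSum e (Matrix.of fun i j => x (.unitary i j))
        (fun i m => x (.source i m)) fun k => c k x}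
      (M * ((2 * n + 1) ^ L + 7 * (n + 1) ^ L) + m + (n + 1) ^ L)
      (M * (convolutionSteps n L + 7 * (n + 1) ^ L) + s + 4 * (n + 1) ^ L + 1) := by
  have h1 := coeff_prod_modePolynomial (ι := Datum M n κ) (L := L) hn
    (fun i j => .unitary (e j) i) (fun i m => .source i m)
  refine ((hc.union h1).trans (sum Finset.univ (m := 1) (s := 2)
    (F := fun (k : Fin L → Fin (n + 1)) (x : Datum M n κ → ℂ) => (starRingEnd ℂ) (c k x) *
      (∏ j, (Real.sqrt ((k j : ℕ).factorial : ℝ) : ℂ)) *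
      (amplitudePolynomial e (Matrix.of fun i j => x (.unitary i j)) fun i m => x (.source i m)).coeff
        (Finsupp.equivFunOnFinite.symm (fun j => (k j : ℕ)))) fun k => ?_)).mono
    subset_rfl subset_rfl ?_ ?_
  · refine ((mul (Or.inr (Or.inl ⟨k, rfl⟩)) (Or.inr (Or.inr ⟨k, rfl⟩))).trans
      (scale 1 (∏ j, (k j : ℕ).factorial) (Or.inr rfl))).mono subset_rfl ?_ le_rfl le_rfl
    rw [Set.singleton_subset_iff, Set.mem_singleton_iff]
    funext x
    -- The product of the square roots is a single admissible constant, so one scaling suffices.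
    have hs : (Real.sqrt ((∏ j, (k j : ℕ).factorial : ℕ) : ℝ) : ℂ) =
        ∏ j, (Real.sqrt ((k j : ℕ).factorial : ℝ) : ℂ) := by
      rw [← Complex.ofReal_prod, Nat.cast_prod, Real.sqrt_prod _ fun j _ => by positivity]
    rw [hs]
    simp only [Pi.mul_apply, amplitudePolynomial_eq, Matrix.of_apply, Rat.cast_one]
    ring
  · simp only [Finset.card_univ, Fintype.card_fin, Fintype.card_pi, Finset.prod_const]
    omega
  · simp only [Finset.card_univ, Fintype.card_fin, Fintype.card_pi, Finset.prod_const]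
    omega

lemma amplitudeSum_zero {M : ℕ} {κ : Type} (e : Fin L ↪ Fin M)
    {c : (Fin L → Fin (0 + 1)) → (Datum M 0 κ → ℂ) → ℂ} {m s : ℕ}
    (hc : Computes ∅ (Set.range fun k x => (starRingEnd ℂ) (c k x)) m s) :
    Computes ∅ {fun x => _root_.amplitudeSum e (Matrix.of fun i j => x (.unitary i j))
        (fun i m => x (.source i m)) fun k => c k x} (M + m + 1) (2 * M + s + 2) := by
  have h1 := prod (S := ∅) Finset.univ fun i : Fin M => input (S := ∅)
    (Datum.source i 0 : Datum M 0 κ)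
  refine ((hc.union h1).trans (mul (Or.inr (Or.inl ⟨default, rfl⟩)) (Or.inr (Or.inr rfl)))).mono
    subset_rfl ?_ ?_ ?_
  · rw [Set.singleton_subset_iff, Set.mem_singleton_iff]
    funext x
    rw [_root_.amplitudeSum_zero]
    rfl
  · simp only [Finset.card_univ, Fintype.card_fin]; omega
  · simp only [Finset.card_univ, Fintype.card_fin]; omega

lemma conj_input (v : ι) {S : Set ((ι → ℂ) → ℂ)} :
    Computes S {fun x => (starRingEnd ℂ) (x v)} 0 2 :=
  (input v).trans (conj (Or.inr rfl))

end Computes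

/-! ### Cost bounds -/

section CostBounds

variable {M L n : ℕ}

/-- For `M ≥ 2` the bases compare directly. For `M = 1` also `L ≤ 1`, and the factor `2` covers `2n
+ 1 ≤ 2(n + 1)`. -/
lemma pow_two_mul_add_one_le (hM : 1 ≤ M) (hL : L ≤ M) :
    (2 * n + 1) ^ L ≤ 2 * (M * n + 1) ^ L := by
  rcases Nat.lt_or_ge M 2 with h | h
  · obtain rfl : M = 1 := by omega
    interval_cases L
    · simp
    · simp
  · calc (2 * n + 1) ^ L ≤ (M * n + 1) ^ L := by gcongr
      _ ≤ _ := by omega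

lemma pow_add_one_le (hM : 1 ≤ M) : (n + 1) ^ L ≤ (M * n + 1) ^ L := by
  gcongr
  exact Nat.le_mul_of_pos_left _ hM

lemma convolutionSteps_le_mul (hM : 1 ≤ M) (hL : L ≤ M) (hn : 1 ≤ n) :
    convolutionSteps n L ≤ 56 * ((n + 1) * (M * n + 1) ^ L) := by
  have h1 := convolutionSteps_le hn L
  have h2 := pow_two_mul_add_one_le (n := n) hM hL
  nlinarith [Nat.mul_le_mul_left (n + 1) h2, Nat.zero_le (n * (2 * n + 1) ^ L),
    Nat.zero_le ((n + 1) ^ (L + 1))]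

/-- For `L ≥ 1`, the surplus factor `n + 1` is merged with one factor `2n + 1`: as `n² ≤ Mn`, their
product is `O(Mn + 1)`. The constant is `326 = 2 + 27 · 12`. -/
lemma convolutionSteps_le_of_le (hM : 1 ≤ M) (hL : L ≤ M) (hn : 1 ≤ n) (hnM : n ≤ M) :
    convolutionSteps n L ≤ 326 * (M * n + 1) ^ L := by
  rcases L with _ | L
  · simp [convolutionSteps]
  have h1 := convolutionSteps_le hn (L + 1)
  have h2 := pow_two_mul_add_one_le (n := n) hM hL
  have h3 : (2 * n + 1) ^ L ≤ 2 * (M * n + 1) ^ L :=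
    pow_two_mul_add_one_le hM (by omega)
  have h4 : (n + 1) * (2 * n + 1) ≤ 6 * (M * n + 1) := by nlinarith
  have h5 : (n + 1) * (2 * n + 1) ^ (L + 1) ≤ 12 * (M * n + 1) ^ (L + 1) := by
    calc (n + 1) * (2 * n + 1) ^ (L + 1) = ((n + 1) * (2 * n + 1)) * (2 * n + 1) ^ L := by ring
      _ ≤ (6 * (M * n + 1)) * (2 * (M * n + 1) ^ L) := by gcongr
      _ = _ := by ring
  nlinarith [Nat.zero_le ((n + 1) ^ (L + 1 + 1))]

end CostBounds

/-- The amplitude is computed within the cost bounds, if the conjugate amplitudes of the low-mode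
state are computed at the cost of a few steps each. -/
theorem exists_amplitude_program {M L n : ℕ} {κ : Type} (hM : 1 ≤ M) (e : Fin L ↪ Fin M)
    (c : (Fin L → Fin (n + 1)) → (κ → ℂ) → ℂ)
    (hc : Computes ∅ (Set.range fun k (x : Datum M n κ → ℂ) =>
        (starRingEnd ℂ) (c k fun p => x (.target p)))
      (4 * (n + 1) ^ L + 3 * L + 2) (4 * (n + 1) ^ L + 3 * L + 2)) :
    ∃ P : List (Instr (Datum M n κ)), WithinCost 400 M L n P ∧
      ∀ (U : Matrix.unitaryGroup (Fin M) ℂ) (V : FockSpace M ≃ₗᵢ[ℂ] FockSpace M)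
        (a : Fin M → Fin (n + 1) → ℂ) (b : κ → ℂ), IsLinearOptical U V →
        programOutput P (inputData (U : Matrix (Fin M) (Fin M) ℂ) a b) =
          inner ℂ (lowModeState e fun k => c k b) (V (productState a)) := by
  have hL : L ≤ M := by simpa using Fintype.card_le_of_embedding e
  rcases Nat.eq_zero_or_pos n with rfl | hn
  · obtain ⟨P, h1, h2, h3⟩ := (Computes.amplitudeSum_zero e hc).exists_program
    simp only [zero_add, one_pow] at h1 h2
    refine ⟨P, ⟨?_, ?_, fun _ => ?_⟩, fun U V a b hV => ?_⟩
    · simp only [mul_zero, zero_add, one_pow]; omega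
    · simp only [mul_zero, zero_add, one_pow]; omega
    · simp only [mul_zero, zero_add, one_pow]; omega
    · rw [h3, inner_lowModeState e a _ hV]
      rfl
  · obtain ⟨P, h1, h2, h3⟩ := (Computes.amplitudeSum hn e hc).exists_program
    have hq := pow_two_mul_add_one_le (n := n) hM hL
    have hr := pow_add_one_le (L := L) (n := n) hM
    have hLr : L ≤ (n + 1) ^ L := (Nat.lt_pow_self (by omega)).le
    have hN : 1 ≤ (M * n + 1) ^ L := Nat.one_le_pow _ _ (by omega)
    have hMN : (M * n + 1) ^ L ≤ M * (M * n + 1) ^ L := Nat.le_mul_of_pos_left _ hM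
    have hMr : M * (n + 1) ^ L ≤ M * (M * n + 1) ^ L := Nat.mul_le_mul_left _ hr
    refine ⟨P, ⟨?_, ?_, fun hnM => ?_⟩, fun U V a b hV => ?_⟩
    · have h4 := Nat.mul_le_mul_left M hq
      rw [mul_add, ← mul_left_comm 7] at h1
      rw [← mul_left_comm 2] at h4
      omega
    · have h4 := Nat.mul_le_mul_left M (convolutionSteps_le_mul hM hL hn)
      have h5 : M * (M * n + 1) ^ L ≤ (n + 1) * (M * (M * n + 1) ^ L) :=
        Nat.le_mul_of_pos_left _ (by omega)
      rw [mul_add, ← mul_left_comm 7] at h2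
      rw [← mul_left_comm 56, mul_left_comm M] at h4
      omega
    · have h4 := Nat.mul_le_mul_left M (convolutionSteps_le_of_le hM hL hn hnM)
      rw [mul_add, ← mul_left_comm 7] at h2
      rw [← mul_left_comm 326] at h4
      omega
    · rw [h3, inner_lowModeState e a _ hV]
      rfl

lemma Computes.conj_productAmplitudes {M L n : ℕ} :
    Computes ∅ (Set.range fun k (x : Datum M n (Fin L × Fin (n + 1)) → ℂ) =>
        (starRingEnd ℂ) (productAmplitudes (fun j m => x (.target (j, m))) k))
      (4 * (n + 1) ^ L + 3 * L + 2) (4 * (n + 1) ^ L + 3 * L + 2) := by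
  simp only [productAmplitudes, map_prod]
  rcases Nat.eq_zero_or_pos n with rfl | hn
  -- With `n = 0` there is one amplitude, a product of `L` conjugated inputs; this is the source of
  -- the term `3L + 2`.
  · refine (Computes.range fun k : Fin L → Fin (0 + 1) => Computes.prod Finset.univ fun j =>
      Computes.conj_input (Datum.target (j, k j))).mono subset_rfl subset_rfl ?_ ?_
    · simp only [Fintype.card_pi, Fintype.card_fin, Finset.prod_const, Finset.card_univ]
      simp; omega
    · simp only [Fintype.card_pi, Fintype.card_fin, Finset.prod_const, Finset.card_univ]
      simp; omega
  · have h1 := Computes.range (S := ∅) fun p : Fin L × Fin (n + 1) =>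
      Computes.conj_input (Datum.target p : Datum M n (Fin L × Fin (n + 1)))
    have hLr : (n + 1) * L ≤ (n + 1) ^ L := Nat.mul_le_pow (by omega) L
    refine (h1.trans (Computes.productTable hn L (fun j m x => (starRingEnd ℂ)
      (x (.target (j, m)))) fun j m => Or.inr ⟨(j, m), rfl⟩)).mono subset_rfl subset_rfl ?_ ?_
    · omega
    · simp only [Fintype.card_prod, Fintype.card_fin]
      nlinarith

lemma Computes.conj_amplitudes {M L n : ℕ} :
    Computes ∅ (Set.range fun k (x : Datum M n (Fin L → Fin (n + 1)) → ℂ) =>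
        (starRingEnd ℂ) (x (.target k)))
      (4 * (n + 1) ^ L + 3 * L + 2) (4 * (n + 1) ^ L + 3 * L + 2) := by
  refine (Computes.range fun k => Computes.conj_input (Datum.target k)).mono subset_rfl
    subset_rfl ?_ ?_
  · omega
  · simp only [Fintype.card_pi, Fintype.card_fin, Finset.prod_const, Finset.card_univ]
    omega

theorem mainTheorem8 :
    -- the amplitude as a sum of coefficients of a polynomial in `L` indeterminates
    (∀ (M L n : ℕ) (e : Fin L ↪ Fin M) (U : Matrix.unitaryGroup (Fin M) ℂ)
        (V : FockSpace M ≃ₗᵢ[ℂ] FockSpace M) (a : Fin M → Fin (n + 1) → ℂ)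
        (c : (Fin L → Fin (n + 1)) → ℂ), IsLinearOptical U V →
      inner ℂ (lowModeState e c) (V (productState a)) =
        ∑ k : Fin L → Fin (n + 1),
          (starRingEnd ℂ) (c k) * (∏ j, (Real.sqrt ((k j : ℕ).factorial : ℝ) : ℂ)) *
            MvPolynomial.coeff (Finsupp.equivFunOnFinite.symm (fun j => (k j : ℕ)))
              (amplitudePolynomial e (U : Matrix (Fin M) (Fin M) ℂ) a)) ∧
    -- exact computation, with an absolute constant
    ∃ C : ℕ, ∀ (M L n : ℕ) (e : Fin L ↪ Fin M), 1 ≤ M →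
      -- arbitrary product state on the `L` modes
      (∃ P : List (Instr (Datum M n (Fin L × Fin (n + 1)))), WithinCost C M L n P ∧
        ∀ (U : Matrix.unitaryGroup (Fin M) ℂ) (V : FockSpace M ≃ₗᵢ[ℂ] FockSpace M)
          (a : Fin M → Fin (n + 1) → ℂ) (b : Fin L → Fin (n + 1) → ℂ), IsLinearOptical U V →
          programOutput P
              (inputData (U : Matrix (Fin M) (Fin M) ℂ) a (fun p => b p.1 p.2)) =
            inner ℂ (lowModeState e (productAmplitudes b)) (V (productState a))) ∧
      -- arbitrary state on the `L` modes, given by its amplitudes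
      (∃ P : List (Instr (Datum M n (Fin L → Fin (n + 1)))), WithinCost C M L n P ∧
        ∀ (U : Matrix.unitaryGroup (Fin M) ℂ) (V : FockSpace M ≃ₗᵢ[ℂ] FockSpace M)
          (a : Fin M → Fin (n + 1) → ℂ) (c : (Fin L → Fin (n + 1)) → ℂ), IsLinearOptical U V →
          programOutput P (inputData (U : Matrix (Fin M) (Fin M) ℂ) a c) =
            inner ℂ (lowModeState e c) (V (productState a))) := by
  -- The most demanding bound is that on the steps for `n ≤ M`: `326` for the convolutions and `22`
  -- for all the rest, below `400`.
  refine ⟨fun M L n e U V a c hV => inner_lowModeState e a c hV, 400, fun M L n e hM => ⟨?_, ?_⟩⟩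
  · obtain ⟨P, hP, h⟩ := exists_amplitude_program hM e
      (fun k b => productAmplitudes (fun j m => b (j, m)) k) Computes.conj_productAmplitudes
    exact ⟨P, hP, fun U V a b hV => h U V a (fun p => b p.1 p.2) hV⟩
  · exact exists_amplitude_program hM e (fun k c => c k) Computes.conj_amplitudes
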